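/- Consider a sequence of regression problems with sample sizes $n\to\infty$ and numbers of covariates $p\to\infty$ (all quantities below may vary along the sequence unless said otherwise). In each problem $y=X\beta^*+w$, where $X$ is a fixed $n\times p$ design with normalized columns, $\frac1n\sum_i x_{ij}^2=1$ for every $j$; $\beta^*\in\mathbb R^p$ has support $S=\{j:\beta^*_j\ne0\}$ with $s=|S|\ge1$ and $|\beta^*_{\min}|=\min_{j\in S}|\beta^*_j|$; and $w_1,\dots,w_n$ are i.i.d. centered sub-Gaussian variables with parameter $\sigma^2>0$, i.e. $\Pr(|w_i|>t)\le2e^{-t^2/(2\sigma^2)}$ for all $t>0$. Put $\Sigma=\frac1nX'X$ and $\rho=\frac1nX'y$, and let $\widehat\Sigma$ (a random $p\times p$ matrix) and $\tilde\rho$ (a random $p$-vector) be surrogates for them, defined on the same probability space as $w$. Write $\|K\|_{\max}=\max_{i,j}|k_{ij}|$ and $\|K\|_\infty=\max_i\sum_j|k_{ij}|$ for matrices. The CoCoLasso estimate is $$\hat\beta\in\arg\min_\beta\ \tfrac12\beta'\widetilde\Sigma\beta-\tilde\rho'\beta+\lambda\|\beta\|_1,\qquad \widetilde\Sigma\in\arg\min_{K\ge0}\|\widehat\Sigma-K\|_{\max},\qquad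 \lambda>0$$ ($K$ ranging over the positive semidefinite matrices; any selection of the minimizers is allowed, and $\hat\beta$ is arbitrary when the first problem has no minimizer). Assume: (i) (closeness) there are constants $C,c>0$, the same along the whole sequence, and numbers $\zeta,\epsilon_0>0$ such that for all $0<\epsilon\le\epsilon_0$ and all $i,j\in\{1,\dots,p\}$, $\Pr(|\widehat\Sigma_{ij}-\Sigma_{ij}|\ge\epsilon)\le C\exp(-cn\epsilon^2\zeta^{-1})$ and $\Pr(|\tilde\rho_j-\rho_j|\ge\epsilon)\le C\exp(-cns^{-2}\epsilon^2\zeta^{-1})$; moreover $\sigma^2=O(\zeta)$; (ii) (irrepresentable and minimum eigenvalue conditions) $\|\Sigma_{S^c,S}\Sigma_{S,S}^{-1}\|_\infty=1-\gamma$ with $\gamma$ bounded below by a positive constant, and $\Lambda_{\min}(\Sigma_{S,S})=C_{\min}>0$; (iii) (bounded constants) $\kappa=4\|\Sigma_{S,S}^{-1}\|_\infty+C_{\min}^{-1/2}=O(1)$ and $\|\beta^*_S\|_\infty=O(1)$; (iv) (scaling) $s^2\log p/n\to0$ and $|\beta^*_{\min}|\gg s(\zeta\log p/n)^{1/2}$;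 (v) (tuning) $|\beta^*_{\min}|\gg\lambda\gg s(\zeta\log p/n)^{1/2}$, and $\lambda\le\min(\epsilon_0,4\epsilon_0/\gamma)$ eventually. Here $a\gg b$ means $b/a\to0$. Then, with probability tending to one, the CoCoLasso criterion has a unique minimizer; CoCoLasso is sign-consistent, $\Pr(\operatorname{sign}(\hat\beta_j)=\operatorname{sign}(\beta^*_j)\text{ for all }j=1,\dots,p)\to1$; and $\Pr(\|\hat\beta_S-\beta^*_S\|_\infty\le\kappa\lambda)\to1$. -/

import Mathlib

open Filter Topology MeasureTheory ProbabilityTheory Asymptotics Matrix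

noncomputable section

namespace CoCoLasso

section MatrixNotions

variable {m n : Type*} [Fintype m] [Fintype n]

open scoped Matrix.Norms.Elementwise in
/-- The elementwise maximum norm `max_{i,j} |k_ij|`. -/
def maxNorm (K : Matrix m n ℝ) : ℝ := ‖K‖

open scoped Matrix.Norms.Operator in
/-- The matrix `ℓ_∞` norm `max_i ∑_j |k_ij|` (maximal absolute row sum; `0` without rows). -/
def linftyNorm (K : Matrix m n ℝ) : ℝ := ‖K‖

/-- The smallest eigenvalue of a (symmetric) matrix. -/
def minEigenvalue [DecidableEq m] (K : Matrix m m ℝ) : ℝ := sInf (spectrum ℝ K)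

/-- `K₁` is a nearest positive semidefinite matrix to `K` in the elementwise maximum norm, that is,
`K₁` belongs to `arg min_{K₁ ≥ 0} ‖K - K₁‖_max`. -/
def IsNearestPSD (K K₁ : Matrix m m ℝ) : Prop :=
  K₁.PosSemidef ∧ ∀ K₂ : Matrix m m ℝ, K₂.PosSemidef → maxNorm (K - K₁) ≤ maxNorm (K - K₂)

/-- The criterion `(1/2) β' A β - r' β + lam ‖β‖₁`. -/
def objective (A : Matrix m m ℝ) (r : m → ℝ) (lam : ℝ) (β : m → ℝ) : ℝ :=
  1 / 2 * (β ⬝ᵥ (A *ᵥ β)) - r ⬝ᵥ β + lam * ∑ j, |β j|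

/-- `b` is a global minimizer of the criterion. -/
def IsSolution (A : Matrix m m ℝ) (r : m → ℝ) (lam : ℝ) (b : m → ℝ) : Prop :=
  ∀ β : m → ℝ, objective A r lam b ≤ objective A r lam β

end MatrixNotions

/-- A real random variable `Z` satisfies `P(|Z| > t) ≤ 2 exp (-t² / (2 σ²))` for all `t > 0`. -/
def SubGaussianTail {Ω : Type*} [MeasurableSpace Ω] (μ : Measure Ω) (Z : Ω → ℝ) (σ : ℝ) : Prop :=
  ∀ t : ℝ, 0 < t → μ.real {ω | t < |Z ω|} ≤ 2 * Real.exp (-(t ^ 2 / (2 * σ ^ 2)))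

/-- The data of a linear regression with `n` observations, `p` covariates, fixed design and
corrupted covariates: the true design `X`, the coefficient vector `βstar`, the noise `w`, and the
surrogates `SigmaHat`, `rhoTilde` computed from the corrupted data. -/
structure Regression (n p : ℕ) (Ω : Type*) where
  X : Matrix (Fin n) (Fin p) ℝ
  βstar : Fin p → ℝ
  w : Ω → Fin n → ℝ
  SigmaHat : Ω → Matrix (Fin p) (Fin p) ℝ
  rhoTilde : Ω → Fin p → ℝ

namespace Regression

variable {n p : ℕ} {Ω : Type*} (M : Regression n p Ω)

/-- The response `y = X βstar + w`. -/
def y (ω : Ω) : Fin n → ℝ := M.X *ᵥ M.βstar + M.w ω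

/-- `Σ = X'X / n`. -/
def Sigma : Matrix (Fin p) (Fin p) ℝ := (1 / (n : ℝ)) • (M.Xᵀ * M.X)

/-- `ρ = X'y / n`. -/
def rho (ω : Ω) : Fin p → ℝ := (1 / (n : ℝ)) • (M.Xᵀ *ᵥ M.y ω)

/-- The true support `S`. -/
def S : Finset (Fin p) := {j | M.βstar j ≠ 0}

/-- The sparsity `s = |S|`. -/
def s : ℕ := M.S.card

/-- `Σ_{S,S}`. -/
def SigmaSS : Matrix {j // j ∈ M.S} {j // j ∈ M.S} ℝ :=
  M.Sigma.submatrix Subtype.val Subtype.val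

/-- `Σ_{Sᶜ,S}`. -/
def SigmaScS : Matrix {j // j ∉ M.S} {j // j ∈ M.S} ℝ :=
  M.Sigma.submatrix Subtype.val Subtype.val

/-- `|β*_min| = min_{j ∈ S} |β*_j|`. -/
def betaMin : ℝ := ⨅ j : {j // j ∈ M.S}, |M.βstar j|

/-- `C_min = Λ_min(Σ_{S,S})`. -/
def Cmin : ℝ := minEigenvalue M.SigmaSS

/-- `κ = 4 ‖Σ_{S,S}⁻¹‖_∞ + C_min^{-1/2}`. -/
def kappa : ℝ := 4 * linftyNorm M.SigmaSS⁻¹ + (Real.sqrt M.Cmin)⁻¹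

/-- The standing assumptions: normalized columns, at least one relevant covariate, and
independent, identically distributed, centered sub-Gaussian noise with parameter `σ²`. -/
structure Standing [MeasurableSpace Ω] (μ : Measure Ω) (σ : ℝ) : Prop where
  columns_normalized : ∀ j, 1 / (n : ℝ) * ∑ i, M.X i j ^ 2 = 1
  support_nonempty : M.S.Nonempty
  sigma_pos : 0 < σ
  measurable_noise : ∀ i, Measurable fun ω => M.w ω i
  indep_noise : iIndepFun (fun i ω => M.w ω i) μ
  identDistrib_noise : ∀ i i', IdentDistrib (fun ω => M.w ω i) (fun ω => M.w ω i') μ μ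
  centered_noise : ∀ i, ∫ ω, M.w ω i ∂μ = 0
  subGaussian_noise : ∀ i, SubGaussianTail μ (fun ω => M.w ω i) σ
  measurable_SigmaHat : ∀ i j, Measurable fun ω => M.SigmaHat ω i j
  measurable_rhoTilde : ∀ j, Measurable fun ω => M.rhoTilde ω j

/-- The closeness condition with constants `C`, `c` and values `ζ`, `ε₀`. -/
def Close [MeasurableSpace Ω] (μ : Measure Ω) (C c ζ ε₀ : ℝ) : Prop :=
  ∀ ε : ℝ, 0 < ε → ε ≤ ε₀ →
    (∀ i j, μ.real {ω | ε ≤ |M.SigmaHat ω i j - M.Sigma i j|}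
      ≤ C * Real.exp (-(c * n * ε ^ 2 / ζ))) ∧
    (∀ j, μ.real {ω | ε ≤ |M.rhoTilde ω j - M.rho ω j|}
      ≤ C * Real.exp (-(c * n * ε ^ 2 / ((M.s : ℝ) ^ 2 * ζ))))

end Regression

/-- `Pr(A k) → 1`, stated through the complements; for non-measurable events this is the strong
form, convergence of the inner probability. -/
def ProbTendstoOne {Ω : ℕ → Type*} [∀ k, MeasurableSpace (Ω k)] (μ : ∀ k, Measure (Ω k))
    (A : ∀ k, Set (Ω k)) : Prop :=
  Tendsto (fun k => μ k (A k)ᶜ) atTop (𝓝 0)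

end CoCoLasso

end

/-!
The result splits into a deterministic statement about the lasso criterion and a union bound.

Deterministic part. Let `Σ` be irrepresentable and well conditioned on `S`, let `A` be positive
semidefinite with `|A - Σ|_max ≤ η`, and let `r` be close to `Σ β*`. On vectors supported on `S`
the perturbation `A - Σ` acts as an operator of `ℓ_∞` norm at most `e = s η`, so `A_{S,S}` stays
injective with `‖v‖ ≤ 2 ‖Σ_{S,S}⁻¹‖_∞ ‖A_{S,S} v‖` once `e ‖Σ_{S,S}⁻¹‖_∞ ≤ 1/2`. Hence the
stationarity equations on `S`, with the signs of `β*` prescribed, have a solution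
`β*_S + u` with `‖u‖_∞ ≤ 4 ‖Σ_{S,S}⁻¹‖_∞ λ`, which is below `|β*_min|`, so the prescribed signs are
the true ones. Off `S` the gradient is controlled through the identity
`Σ_{Sᶜ,S} u = (Σ_{Sᶜ,S} Σ_{S,S}⁻¹) (Σ_{S,S} u)`, in which no inverse of the perturbed block occurs;
the irrepresentable condition leaves it strictly inside `[-λ, λ]`. Strictness off `S`, positive
semidefiniteness of `A` and injectivity of `A_{S,S}` make this the only minimizer
(`exists_unique_solution_near`). The projected surrogate qualifies as `A`: it is positive
semidefinite, and since `Σ` is a competitor in the projection, its distance to `Σ` is at most twice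
that of the unprojected surrogate (`IsNearestPSD.abs_apply_sub_le`).

Probabilistic part. It suffices that the entrywise errors of the surrogates of `Σ` and `ρ` and the
projected noise `X'w / n` are below `δ λ / (2 s)`, `δ λ` and `δ λ` for a small constant `δ`.
Sub-Gaussian tails are turned into a moment generating function bound by a layer-cake computation of
`E exp (Z² / (4 σ²))` (`SubGaussianTail.hasSubgaussianMGF`), which gives a tail bound for `X'w / n`.
As `λ` dominates `s (ζ log p / n)^{1/2}` and `σ² = O(ζ)`, all three exponents eventually exceed
`3 log p`, so the union bound over at most `p²` entries is of order `1 / p`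
(`probTendstoOne_goodEvent`).
-/

/-! ### Sub-Gaussian tails and moment generating functions -/

namespace CoCoLasso

/-- The linear term on the right vanishes in expectation for centered variables. -/
lemma exp_le_self_add_exp_sq (x : ℝ) : Real.exp x ≤ x + Real.exp (x ^ 2) := by
  have h2 := Real.add_one_le_exp (x ^ 2)
  rcases le_or_gt |x| 1 with h | h
  · have h1 := (abs_le.1 (Real.abs_exp_sub_one_sub_id_le h)).2
    linarith
  · rcases lt_abs.1 h with h | h
    · have : Real.exp x ≤ Real.exp (x ^ 2) := Real.exp_le_exp.2 (by nlinarith)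
      linarith
    · have : Real.exp x ≤ 1 := Real.exp_le_one_iff.2 (by linarith)
      nlinarith

lemma exp_mul_le_of_mem_unitInterval {θ : ℝ} (h0 : 0 ≤ θ) (h1 : θ ≤ 1) (y : ℝ) :
    Real.exp (θ * y) ≤ 1 - θ + θ * Real.exp y := by
  have h := convexOn_exp.2 (Set.mem_univ (0 : ℝ)) (Set.mem_univ y) (sub_nonneg.2 h1) h0
    (by ring)
  simpa using h

section SubGaussian

variable {Ω : Type*} [MeasurableSpace Ω] {μ : Measure Ω} [IsProbabilityMeasure μ]

/-- By the layer-cake formula, the tail bound with exponent `t² / (2 σ²)` controls the exponential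
moment of `Z²` at half the critical rate. -/
lemma lintegral_exp_sq_sub_one_le {Z : Ω → ℝ} {σ : ℝ} (hσ : 0 < σ)
    (hZ : Measurable Z) (h : SubGaussianTail μ Z σ) :
    ∫⁻ ω, ENNReal.ofReal (Real.exp (Z ω ^ 2 / (4 * σ ^ 2)) - 1) ∂μ ≤ 2 := by
  set b : ℝ := 1 / (4 * σ ^ 2) with hb
  have hb0 : 0 < b := by positivity
  let g : ℝ → ℝ := fun t => 2 * b * t * Real.exp (b * t ^ 2)
  have hg : Continuous g := by fun_prop
  have hder : ∀ t : ℝ, HasDerivAt (fun t => Real.exp (b * t ^ 2)) (g t) t := by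
    intro t
    have := ((hasDerivAt_pow 2 t).const_mul b).exp
    convert this using 1
    push_cast; ring
  have hint : ∀ x : ℝ, ∫ t in (0 : ℝ)..x, g t = Real.exp (b * x ^ 2) - 1 := by
    intro x
    rw [intervalIntegral.integral_eq_sub_of_hasDerivAt (fun t _ => hder t)
      (hg.intervalIntegrable _ _)]
    simp
  have key := lintegral_comp_eq_lintegral_meas_lt_mul μ (f := fun ω => |Z ω|) (g := g)
    (Eventually.of_forall fun ω => abs_nonneg _) (hZ.abs.aemeasurable)
    (fun t _ => hg.intervalIntegrable _ _)
    ((ae_restrict_iff' measurableSet_Ioi).2 <| Eventually.of_forall fun t ht => by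
      have : (0 : ℝ) < t := ht
      simp only [g]; positivity)
  have hlhs : ∀ ω, Real.exp (Z ω ^ 2 / (4 * σ ^ 2)) - 1 = ∫ t in (0 : ℝ)..|Z ω|, g t := by
    intro ω
    rw [hint, sq_abs, hb]; congr 2; ring
  simp_rw [hlhs]
  rw [key]
  -- the tail bound turns the integrand into the derivative of `-2 exp (-b t²)`
  let F : ℝ → ℝ := fun t => -2 * Real.exp (-b * t ^ 2)
  let F' : ℝ → ℝ := fun t => 4 * b * t * Real.exp (-b * t ^ 2)
  have hF : ∀ t ∈ Set.Ici (0 : ℝ), HasDerivAt F (F' t) t := by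
    intro t _
    refine ((((hasDerivAt_pow 2 t).const_mul (-b)).exp).const_mul (-2)).congr_deriv ?_
    simp only [F']; push_cast; ring
  have hFnn : ∀ t ∈ Set.Ioi (0 : ℝ), 0 ≤ F' t := by
    intro t ht
    have : (0 : ℝ) < t := ht
    simp only [F']; positivity
  have hlim : Tendsto F atTop (𝓝 0) := by
    have h1 : Tendsto (fun t : ℝ => -b * t ^ 2) atTop atBot :=
      (tendsto_pow_atTop two_ne_zero).const_mul_atTop_of_neg (by linarith)
    simpa [F] using (Real.tendsto_exp_atBot.comp h1).const_mul (-2)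
  have hI := integral_Ioi_of_hasDerivAt_of_nonneg' hF hFnn hlim
  have hInt := integrableOn_Ioi_deriv_of_nonneg' hF hFnn hlim
  calc ∫⁻ t in Set.Ioi 0, μ {a | t < |Z a|} * ENNReal.ofReal (g t)
      ≤ ∫⁻ t in Set.Ioi 0, ENNReal.ofReal (F' t) := by
        refine setLIntegral_mono' measurableSet_Ioi fun t ht => ?_
        have ht : (0 : ℝ) < t := ht
        have hg0 : 0 ≤ g t := by simp only [g]; positivity
        rw [← ofReal_measureReal (measure_ne_top μ _), ← ENNReal.ofReal_mul (by positivity)]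
        refine ENNReal.ofReal_le_ofReal ((mul_le_mul_of_nonneg_right (h t ht) hg0).trans_eq ?_)
        simp only [g, F']
        rw [show -b * t ^ 2 = -(t ^ 2 / (2 * σ ^ 2)) + b * t ^ 2 by rw [hb]; field_simp; norm_num,
          Real.exp_add]
        ring
    _ = ENNReal.ofReal (∫ t in Set.Ioi 0, F' t) :=
        (ofReal_integral_eq_lintegral_ofReal hInt
          ((ae_restrict_iff' measurableSet_Ioi).2 (Eventually.of_forall hFnn))).symm
    _ ≤ 2 := by
        rw [hI]; simp [F]

lemma SubGaussianTail.integrable_exp_sq {Z : Ω → ℝ} {σ : ℝ} (hσ : 0 < σ)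
    (hZ : Measurable Z) (h : SubGaussianTail μ Z σ) :
    Integrable (fun ω => Real.exp (Z ω ^ 2 / (4 * σ ^ 2))) μ ∧
      ∫ ω, Real.exp (Z ω ^ 2 / (4 * σ ^ 2)) ∂μ ≤ 3 := by
  have hl := lintegral_exp_sq_sub_one_le hσ hZ h
  have hnn : ∀ ω, 0 ≤ Real.exp (Z ω ^ 2 / (4 * σ ^ 2)) - 1 := fun ω => by
    have := Real.add_one_le_exp (Z ω ^ 2 / (4 * σ ^ 2))
    have : 0 ≤ Z ω ^ 2 / (4 * σ ^ 2) := by positivity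
    linarith
  have hm : Measurable fun ω => Real.exp (Z ω ^ 2 / (4 * σ ^ 2)) - 1 := by fun_prop
  have hi : Integrable (fun ω => Real.exp (Z ω ^ 2 / (4 * σ ^ 2)) - 1) μ := by
    refine ⟨hm.aestronglyMeasurable, ?_⟩
    rw [hasFiniteIntegral_iff_ofReal (Eventually.of_forall hnn)]
    exact hl.trans_lt (by simp)
  have hi' : Integrable (fun ω => Real.exp (Z ω ^ 2 / (4 * σ ^ 2))) μ := by
    have h1 := hi.add (integrable_const (1 : ℝ))
    refine h1.congr (Eventually.of_forall fun ω => ?_)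
    simp
  refine ⟨hi', ?_⟩
  have h2 : ∫ ω, (Real.exp (Z ω ^ 2 / (4 * σ ^ 2)) - 1) ∂μ ≤ 2 := by
    rw [integral_eq_lintegral_of_nonneg_ae (Eventually.of_forall hnn) hm.aestronglyMeasurable]
    exact ENNReal.toReal_le_of_le_ofReal (by norm_num) (by simpa using hl)
  rw [integral_sub hi' (integrable_const _)] at h2
  simp at h2
  linarith

/-- A centered variable with sub-Gaussian tails of parameter `σ²` has a sub-Gaussian moment
generating function, with variance proxy `16 σ²`. -/
lemma SubGaussianTail.hasSubgaussianMGF {Z : Ω → ℝ} {σ : ℝ} (hσ : 0 < σ)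
    (hZ : Measurable Z) (h : SubGaussianTail μ Z σ) (h0 : ∫ ω, Z ω ∂μ = 0) :
    HasSubgaussianMGF Z (16 * σ ^ 2).toNNReal μ := by
  obtain ⟨hi, h3⟩ := h.integrable_exp_sq hσ hZ
  set E : Ω → ℝ := fun ω => Real.exp (Z ω ^ 2 / (4 * σ ^ 2)) with hE
  have hσ2 : 0 < σ ^ 2 := by positivity
  have hyoung : ∀ t ω, Real.exp (t * Z ω) ≤ Real.exp (t ^ 2 * σ ^ 2) * E ω := by
    intro t ω
    rw [hE, ← Real.exp_add, Real.exp_le_exp]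
    have : t ^ 2 * σ ^ 2 + Z ω ^ 2 / (4 * σ ^ 2) - t * Z ω
        = (t * σ - Z ω / (2 * σ)) ^ 2 := by field_simp; ring
    nlinarith [sq_nonneg (t * σ - Z ω / (2 * σ))]
  have hexp : ∀ t : ℝ, Integrable (fun ω => Real.exp (t * Z ω)) μ := fun t =>
    (hi.const_mul (Real.exp (t ^ 2 * σ ^ 2))).mono' (by fun_prop)
      (Eventually.of_forall fun ω => by
        rw [Real.norm_eq_abs, abs_of_pos (Real.exp_pos _)]; exact hyoung t ω)
  have hZi : Integrable Z μ := by
    refine ((hexp 1).add (hexp (-1))).mono' hZ.aestronglyMeasurable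
      (Eventually.of_forall fun ω => ?_)
    have h1 := Real.add_one_le_exp (1 * Z ω)
    have h2 := Real.add_one_le_exp (-1 * Z ω)
    have h3 := Real.exp_pos (1 * Z ω)
    have h4 := Real.exp_pos (-1 * Z ω)
    rw [Real.norm_eq_abs, abs_le]
    simp only [Pi.add_apply]
    constructor <;> linarith
  refine ⟨hexp, fun t => ?_⟩
  rw [Real.coe_toNNReal _ (by positivity), mgf]
  -- small `t` uses centering, to get a bound tending to `1`; large `t` only needs Young's inequality
  rcases le_or_gt (4 * σ ^ 2 * t ^ 2) 1 with ht | ht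
  · set θ := 4 * σ ^ 2 * t ^ 2 with hθ
    have hθ0 : 0 ≤ θ := by positivity
    calc ∫ ω, Real.exp (t * Z ω) ∂μ ≤ ∫ ω, (t * Z ω + (1 - θ) + θ * E ω) ∂μ := by
          refine integral_mono (hexp t) (((hZi.const_mul t).add (integrable_const _)).add
            (hi.const_mul θ)) fun ω => ?_
          have h1 := exp_le_self_add_exp_sq (t * Z ω)
          have h2 := exp_mul_le_of_mem_unitInterval hθ0 ht (Z ω ^ 2 / (4 * σ ^ 2))
          rw [show θ * (Z ω ^ 2 / (4 * σ ^ 2)) = (t * Z ω) ^ 2 by rw [hθ]; field_simp] at h2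
          simp only [hE]; linarith
      _ = 1 - θ + θ * ∫ ω, E ω ∂μ := by
          have h1 : Integrable (fun ω => t * Z ω + (1 - θ)) μ :=
            (hZi.const_mul t).add (integrable_const _)
          rw [integral_add h1 (hi.const_mul θ),
            integral_add (hZi.const_mul t) (integrable_const _), integral_const_mul,
            integral_const_mul, h0]
          simp
      _ ≤ 2 * θ + 1 := by nlinarith
      _ ≤ Real.exp (2 * θ) := Real.add_one_le_exp _
      _ = Real.exp (16 * σ ^ 2 * t ^ 2 / 2) := by rw [hθ]; congr 1; ring
  · have h4 : (3 : ℝ) ≤ Real.exp (7 * (σ ^ 2 * t ^ 2)) := by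
      have h1 : Real.exp 1 * Real.exp (3 / 4) ≤ Real.exp (7 * (σ ^ 2 * t ^ 2)) := by
        rw [← Real.exp_add, Real.exp_le_exp]; linarith
      have := Real.exp_one_gt_d9
      have := Real.add_one_le_exp (3 / 4 : ℝ)
      nlinarith
    calc ∫ ω, Real.exp (t * Z ω) ∂μ ≤ ∫ ω, Real.exp (t ^ 2 * σ ^ 2) * E ω ∂μ :=
          integral_mono (hexp t) (hi.const_mul _) (hyoung t)
      _ = Real.exp (t ^ 2 * σ ^ 2) * ∫ ω, E ω ∂μ := integral_const_mul _ _
      _ ≤ Real.exp (t ^ 2 * σ ^ 2) * Real.exp (7 * (σ ^ 2 * t ^ 2)) := by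
          gcongr; exact h3.trans h4
      _ = Real.exp (16 * σ ^ 2 * t ^ 2 / 2) := by rw [← Real.exp_add]; congr 1; ring

end SubGaussian

namespace Regression

variable {n p : ℕ} {Ω : Type*} {M : Regression n p Ω} [MeasurableSpace Ω] {μ : Measure Ω}
  [IsProbabilityMeasure μ] {σ : ℝ}

/-- Normalized columns give each entry of `X'w / n` the variance proxy `16 σ² / n`. -/
lemma Standing.measureReal_abs_noise_ge_le (hM : M.Standing μ σ) (hn : 0 < n) (j : Fin p)
    {t : ℝ} (ht : 0 ≤ t) :
    μ.real {ω | t ≤ |((1 / (n : ℝ)) • (M.Xᵀ *ᵥ M.w ω)) j|}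
      ≤ 2 * Real.exp (-(n * t ^ 2 / (32 * σ ^ 2))) := by
  have hn' : (0 : ℝ) < n := by exact_mod_cast hn
  have hσ := hM.sigma_pos
  let a : Fin n → ℝ := fun i => 1 / n * M.X i j
  let v : Fin n → NNReal := fun i => ⟨a i ^ 2, sq_nonneg _⟩
  have hv : ∀ i, (v i : ℝ) = a i ^ 2 := fun i => rfl
  have hsub : ∀ i ∈ Finset.univ, HasSubgaussianMGF (fun ω => a i * M.w ω i)
      (v i * (16 * σ ^ 2).toNNReal) μ := fun i _ =>
    (SubGaussianTail.hasSubgaussianMGF hσ (hM.measurable_noise i) (hM.subGaussian_noise i)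
      (hM.centered_noise i)).const_mul (a i)
  have hind : iIndepFun (fun i ω => a i * M.w ω i) μ :=
    hM.indep_noise.comp (fun i x => a i * x) (fun i => by fun_prop)
  have hsum := HasSubgaussianMGF.sum_of_iIndepFun hind hsub
  have hc : ((∑ i, v i * (16 * σ ^ 2).toNNReal : NNReal) : ℝ)
      = 16 * σ ^ 2 / n := by
    have h1 := hM.columns_normalized j
    push_cast
    rw [← Finset.sum_mul, Real.coe_toNNReal _ (by positivity)]
    have : ∑ i, a i ^ 2 = 1 / n := by
      calc ∑ i, a i ^ 2 = 1 / n * (1 / n * ∑ i, M.X i j ^ 2) := by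
            simp only [a, Finset.mul_sum]
            exact Finset.sum_congr rfl fun i _ => by ring
        _ = 1 / n := by rw [h1, mul_one]
    simp only [hv]
    rw [this]; ring
  have hZ : ∀ ω, ((1 / (n : ℝ)) • (M.Xᵀ *ᵥ M.w ω)) j = ∑ i, a i * M.w ω i := fun ω => by
    simp only [Pi.smul_apply, mulVec, dotProduct, transpose_apply, smul_eq_mul, Finset.mul_sum, a]
    exact Finset.sum_congr rfl fun i _ => by ring
  have hexp : ∀ s : ℝ, s ^ 2 = t ^ 2 →
      -s ^ 2 / (2 * (16 * σ ^ 2 / n)) = -(n * t ^ 2 / (32 * σ ^ 2)) := fun s hs => by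
    rw [hs]; field_simp; ring
  have h1 := hsum.measure_ge_le ht
  have h2 := hsum.neg.measure_ge_le ht
  rw [hc, hexp t rfl] at h1 h2
  calc μ.real {ω | t ≤ |((1 / (n : ℝ)) • (M.Xᵀ *ᵥ M.w ω)) j|}
      ≤ μ.real ({ω | t ≤ ∑ i, a i * M.w ω i} ∪
          {ω | t ≤ (-fun ω => ∑ i, a i * M.w ω i) ω}) := by
        refine measureReal_mono fun ω hω => ?_
        have hω' : t ≤ |((1 / (n : ℝ)) • (M.Xᵀ *ᵥ M.w ω)) j| := hω
        rw [hZ, le_abs] at hω'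
        exact hω'
    _ ≤ _ := measureReal_union_le _ _
    _ ≤ _ := by linarith

end Regression

end CoCoLasso

/-! ### Uniqueness and support recovery for the lasso criterion -/

namespace CoCoLasso

section Lasso

variable {ι : Type*} [Fintype ι]

lemma objective_sub_objective {A : Matrix ι ι ℝ} (hA : A.IsHermitian) (r : ι → ℝ) (lam : ℝ)
    (b β : ι → ℝ) :
    objective A r lam β - objective A r lam b = 1 / 2 * ((β - b) ⬝ᵥ (A *ᵥ (β - b)))
      + ∑ j, (((A *ᵥ b) j - r j) * (β j - b j) + lam * (|β j| - |b j|)) := by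
  have hT : Aᵀ = A := by simpa [conjTranspose_eq_transpose_of_trivial] using hA.eq
  have hsym : b ⬝ᵥ (A *ᵥ β) = β ⬝ᵥ (A *ᵥ b) := by
    rw [dotProduct_mulVec, ← mulVec_transpose, hT, dotProduct_comm]
  have h1 : ∑ j, (((A *ᵥ b) j - r j) * (β j - b j) + lam * (|β j| - |b j|))
      = β ⬝ᵥ (A *ᵥ b) - b ⬝ᵥ (A *ᵥ b) - r ⬝ᵥ β + r ⬝ᵥ b + lam * ∑ j, |β j|
        - lam * ∑ j, |b j| := by
    simp only [dotProduct, Finset.mul_sum, ← Finset.sum_sub_distrib, ← Finset.sum_add_distrib]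
    exact Finset.sum_congr rfl fun j _ => by ring
  rw [h1, objective, objective, mulVec_sub, dotProduct_sub, sub_dotProduct, sub_dotProduct, hsym]
  ring

/-- A point that satisfies the stationarity conditions of the lasso criterion, strictly off the
set `S`, is the only minimizer as soon as the quadratic form is definite on vectors supported
on `S`. -/
lemma isSolution_and_unique_of_strict_dual_feasible {A : Matrix ι ι ℝ} (hA : A.PosSemidef)
    {r : ι → ℝ} {lam : ℝ} (hlam : 0 ≤ lam) {b : ι → ℝ} {S : Finset ι}
    (hS : ∀ j ∈ S, (A *ᵥ b) j - r j = -(lam * (SignType.sign (b j) : ℝ)))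
    (hb : ∀ j ∉ S, b j = 0) (hSc : ∀ j ∉ S, |(A *ᵥ b) j - r j| < lam)
    (hinj : ∀ v : ι → ℝ, (∀ j ∉ S, v j = 0) → (∀ j ∈ S, (A *ᵥ v) j = 0) → v = 0) :
    IsSolution A r lam b ∧ ∀ b', IsSolution A r lam b' → b' = b := by
  have hterm : ∀ (β : ι → ℝ) (j : ι),
      0 ≤ ((A *ᵥ b) j - r j) * (β j - b j) + lam * (|β j| - |b j|) := by
    intro β j
    by_cases hj : j ∈ S
    · have h1 : b j * (SignType.sign (b j) : ℝ) = |b j| := self_mul_sign (b j)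
      have h2 : (SignType.sign (b j) : ℝ) * β j ≤ |β j| := by
        refine (le_abs_self _).trans ?_
        rw [abs_mul]
        refine mul_le_of_le_one_left (abs_nonneg _) ?_
        rcases lt_trichotomy (b j) 0 with h | h | h <;> simp [h]
      rw [hS j hj, ← h1]
      nlinarith [mul_nonneg hlam (sub_nonneg.2 h2)]
    · rw [hb j hj]
      have h1 := neg_abs_le (((A *ᵥ b) j - r j) * β j)
      rw [abs_mul] at h1
      have h2 := mul_nonneg (sub_nonneg.2 (hSc j hj).le) (abs_nonneg (β j))
      simp only [sub_zero, abs_zero]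
      linarith
  have hquad : ∀ v : ι → ℝ, 0 ≤ v ⬝ᵥ (A *ᵥ v) := fun v => by
    simpa using hA.dotProduct_mulVec_nonneg v
  have hsum : ∀ β : ι → ℝ,
      0 ≤ ∑ j, (((A *ᵥ b) j - r j) * (β j - b j) + lam * (|β j| - |b j|)) := fun β =>
    Finset.sum_nonneg fun j _ => hterm β j
  refine ⟨fun β => ?_, fun b' hb' => ?_⟩
  · have h1 := objective_sub_objective hA.1 r lam b β
    linarith [hquad (β - b), hsum β]
  · have h1 := objective_sub_objective hA.1 r lam b b'
    have h2 := hb' b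
    have h3 : (b' - b) ⬝ᵥ (A *ᵥ (b' - b)) = 0 := by linarith [hquad (b' - b), hsum b']
    have h4 : ∑ j, (((A *ᵥ b) j - r j) * (b' j - b j) + lam * (|b' j| - |b j|)) = 0 := by
      linarith [hquad (b' - b), hsum b']
    have h5 : A *ᵥ (b' - b) = 0 := (hA.dotProduct_mulVec_zero_iff _).1 (by simpa using h3)
    have h6 := (Finset.sum_eq_zero_iff_of_nonneg fun j _ => hterm b' j).1 h4
    refine sub_eq_zero.1 (hinj _ (fun j hj => ?_) fun j _ => by rw [h5]; rfl)
    have h7 := h6 j (Finset.mem_univ j)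
    rw [hb j hj, sub_zero, abs_zero, sub_zero] at h7
    have h8 := neg_abs_le (((A *ᵥ b) j - r j) * b' j)
    rw [abs_mul] at h8
    have h9 : (lam - |(A *ᵥ b) j - r j|) * |b' j| ≤ 0 := by linarith
    have h10 : |b' j| ≤ 0 := by
      by_contra hne
      exact absurd h9 (not_le.2 (mul_pos (sub_pos.2 (hSc j hj)) (not_le.1 hne)))
    simpa [hb j hj] using h10

end Lasso

section MatrixBounds

open scoped Matrix.Norms.Operator in
lemma norm_mulVec_le_linftyNorm {m n : Type*} [Fintype m] [Fintype n] (K : Matrix m n ℝ)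
    (v : n → ℝ) : ‖K *ᵥ v‖ ≤ linftyNorm K * ‖v‖ :=
  linfty_opNorm_mulVec K v

open scoped Matrix.Norms.Operator in
lemma linftyNorm_nonneg {m n : Type*} [Fintype m] [Fintype n] (K : Matrix m n ℝ) :
    0 ≤ linftyNorm K :=
  norm_nonneg K

open scoped Matrix.Norms.Elementwise in
lemma abs_apply_le_maxNorm {m n : Type*} [Fintype m] [Fintype n] (K : Matrix m n ℝ) (i : m)
    (j : n) : |K i j| ≤ maxNorm K :=
  norm_entry_le_entrywise_sup_norm K

open scoped Matrix.Norms.Elementwise in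
lemma maxNorm_le_of_forall {m n : Type*} [Fintype m] [Fintype n] {K : Matrix m n ℝ} {ε : ℝ}
    (hε : 0 ≤ ε) (h : ∀ i j, |K i j| ≤ ε) : maxNorm K ≤ ε :=
  (norm_le_iff hε).2 h

/-- Projecting onto the positive semidefinite cone at most doubles the distance to a positive
semidefinite matrix. -/
lemma IsNearestPSD.abs_apply_sub_le {m : Type*} [Fintype m] {K K₁ K₀ : Matrix m m ℝ}
    (h : IsNearestPSD K K₁) (h₀ : K₀.PosSemidef) {ε : ℝ} (hε : 0 ≤ ε)
    (hK : ∀ i j, |K i j - K₀ i j| ≤ ε) (i j : m) : |K₁ i j - K₀ i j| ≤ 2 * ε := by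
  have h1 := (abs_apply_le_maxNorm (K - K₁) i j).trans
    ((h.2 K₀ h₀).trans (maxNorm_le_of_forall hε hK))
  have h2 := hK i j
  rw [Matrix.sub_apply] at h1
  rw [abs_le] at *
  constructor <;> linarith

lemma isUnit_of_minEigenvalue_pos {m : Type*} [Fintype m] [DecidableEq m] {K : Matrix m m ℝ}
    (h : 0 < minEigenvalue K) : IsUnit K := by
  by_contra hu
  have h0 : (0 : ℝ) ∈ spectrum ℝ K := spectrum.zero_mem ℝ hu
  exact absurd (csInf_le (finite_real_spectrum).bddBelow h0) (not_le.2 h)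

end MatrixBounds

section PrimalDual

variable {ι : Type*}

lemma sum_eq_sum_subtype_of_support [Fintype ι] {S : Finset ι} {v : ι → ℝ}
    (hv : ∀ j ∉ S, v j = 0) (a : ι → ℝ) :
    ∑ j, a j * v j = ∑ j : {j // j ∈ S}, a j * v j := by
  rw [Finset.sum_coe_sort S (fun j => a j * v j)]
  exact (Finset.sum_subset (Finset.subset_univ S) fun j _ hj => by rw [hv j hj, mul_zero]).symm

lemma abs_sum_mul_le {S : Finset ι} {η : ℝ} {a : ι → ℝ} (ha : ∀ j, |a j| ≤ η)
    (v : {j // j ∈ S} → ℝ) : |∑ j : {j // j ∈ S}, a j * v j| ≤ S.card * η * ‖v‖ := by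
  calc |∑ j : {j // j ∈ S}, a j * v j| ≤ ∑ j : {j // j ∈ S}, |a j * v j| :=
        Finset.abs_sum_le_sum_abs _ _
    _ ≤ ∑ _j : {j // j ∈ S}, η * ‖v‖ := Finset.sum_le_sum fun j _ => by
        rw [abs_mul]
        exact mul_le_mul (ha j) (norm_le_pi_norm v j) (abs_nonneg _)
          ((abs_nonneg _).trans (ha j))
    _ = S.card * η * ‖v‖ := by simp [mul_assoc]

lemma sign_eq_of_abs_sub_lt {x y : ℝ} (h : |x - y| < |y|) :
    SignType.sign x = SignType.sign y := by
  rcases lt_trichotomy y 0 with hy | hy | hy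
  · rw [abs_of_neg hy, abs_lt] at h
    rw [sign_neg hy, sign_neg (by linarith)]
  · rw [hy, abs_zero] at h
    exact absurd h (not_lt.2 (abs_nonneg _))
  · rw [abs_of_pos hy, abs_lt] at h
    rw [sign_pos hy, sign_pos (by linarith)]

/-- The primal-dual witness construction. If the surrogates `A` and `r` are close to a population
matrix `A₀` that is well conditioned and irrepresentable on `S`, and to `A₀ *ᵥ b₀`, then solving
the stationarity equations on `S` with the signs of `b₀` yields the unique lasso solution. Here
`e` bounds the perturbation of the row sums over `S`, `d` bounds the effective noise
`r - A *ᵥ b₀`, and `L` is the `ℓ_∞` norm of the inverse block. -/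
lemma exists_unique_solution_near [Fintype ι] [DecidableEq ι] {A A₀ : Matrix ι ι ℝ} (hA : A.PosSemidef) {r b₀ : ι → ℝ}
    {S : Finset ι} {lam γ L η e d : ℝ} (hlam : 0 < lam) (hγ : γ ≤ 1)
    (hb₀ : ∀ j ∉ S, b₀ j = 0)
    (hunit : IsUnit (A₀.submatrix Subtype.val Subtype.val :
      Matrix {j // j ∈ S} {j // j ∈ S} ℝ))
    (hL : linftyNorm (A₀.submatrix Subtype.val Subtype.val :
      Matrix {j // j ∈ S} {j // j ∈ S} ℝ)⁻¹ = L)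
    (hirr : linftyNorm ((A₀.submatrix Subtype.val Subtype.val :
      Matrix {j // j ∉ S} {j // j ∈ S} ℝ) * (A₀.submatrix Subtype.val Subtype.val :
      Matrix {j // j ∈ S} {j // j ∈ S} ℝ)⁻¹) ≤ 1 - γ)
    (hη : ∀ i j, |A i j - A₀ i j| ≤ η) (he : S.card * η ≤ e) (he0 : 0 ≤ e)
    (hd : ∀ j, |r j - (A *ᵥ b₀) j| ≤ d) (hLe : L * e ≤ 1 / 2) (hd0 : 0 ≤ d) (hdlam : d ≤ lam)
    (hdual : 2 * d + 8 * (e * L * lam) < γ * lam)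
    (hmin : ∀ j ∈ S, 4 * L * lam < |b₀ j|) :
    ∃ b, IsSolution A r lam b ∧ (∀ b', IsSolution A r lam b' → b' = b) ∧
      (∀ j, SignType.sign (b j) = SignType.sign (b₀ j)) ∧
      ∀ j ∈ S, |b j - b₀ j| ≤ 4 * L * lam := by
  set K₀ : Matrix {j // j ∈ S} {j // j ∈ S} ℝ := A₀.submatrix Subtype.val Subtype.val with hK₀
  set N₀ : Matrix {j // j ∉ S} {j // j ∈ S} ℝ := A₀.submatrix Subtype.val Subtype.val with hN₀
  let K : Matrix {j // j ∈ S} {j // j ∈ S} ℝ := A.submatrix Subtype.val Subtype.val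
  have hdet : IsUnit K₀.det := (isUnit_iff_isUnit_det _).1 hunit
  have hL0 : 0 ≤ L := hL ▸ linftyNorm_nonneg _
  have hpert : ∀ (i : ι) (v : {j // j ∈ S} → ℝ),
      |∑ j : {j // j ∈ S}, (A i j - A₀ i j) * v j| ≤ e * ‖v‖ := fun i v =>
    (abs_sum_mul_le (hη i) v).trans (mul_le_mul_of_nonneg_right he (norm_nonneg _))
  have hK₀v : ∀ v : {j // j ∈ S} → ℝ, ‖K₀ *ᵥ v‖ ≤ ‖K *ᵥ v‖ + e * ‖v‖ := by
    intro v
    have hdiff : ‖K *ᵥ v - K₀ *ᵥ v‖ ≤ e * ‖v‖ := by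
      refine (pi_norm_le_iff_of_nonneg (by positivity)).2 fun i => ?_
      rw [← sub_mulVec]
      exact hpert i v
    calc ‖K₀ *ᵥ v‖ = ‖K *ᵥ v - (K *ᵥ v - K₀ *ᵥ v)‖ := by rw [sub_sub_cancel]
      _ ≤ ‖K *ᵥ v‖ + ‖K *ᵥ v - K₀ *ᵥ v‖ := norm_sub_le _ _
      _ ≤ _ := by linarith
  have hbound : ∀ v : {j // j ∈ S} → ℝ, ‖v‖ ≤ 2 * L * ‖K *ᵥ v‖ := by
    intro v
    have h1 : ‖v‖ ≤ L * ‖K₀ *ᵥ v‖ := by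
      have h := norm_mulVec_le_linftyNorm K₀⁻¹ (K₀ *ᵥ v)
      rwa [mulVec_mulVec, nonsing_inv_mul _ hdet, one_mulVec, hL] at h
    have h2 := mul_le_mul_of_nonneg_left (hK₀v v) hL0
    have h3 := mul_le_mul_of_nonneg_right hLe (norm_nonneg v)
    linarith
  have hinjK : Function.Injective K.mulVec := by
    intro v w hvw
    have h := hbound (v - w)
    have h0 : K *ᵥ (v - w) = 0 := by rw [mulVec_sub]; exact sub_eq_zero.2 hvw
    rw [h0, norm_zero, mul_zero] at h
    exact sub_eq_zero.1 (norm_le_zero_iff.1 h)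
  -- the right-hand side for the error on `S` forced by stationarity with the signs of `b₀`
  let q : {j // j ∈ S} → ℝ := fun j =>
    r j - (A *ᵥ b₀) j - lam * (SignType.sign (b₀ j) : ℝ)
  obtain ⟨u, hu⟩ : ∃ u, K *ᵥ u = q :=
    (mulVec_surjective_iff_isUnit.2 (mulVec_injective_iff_isUnit.1 hinjK)) q
  have hsign1 : ∀ x : ℝ, |(SignType.sign x : ℝ)| ≤ 1 := by
    intro x
    rcases lt_trichotomy x 0 with h | h | h <;> simp [h]
  have hq : ‖q‖ ≤ d + lam := by
    refine (pi_norm_le_iff_of_nonneg (by linarith)).2 fun j => ?_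
    refine (abs_sub _ _).trans (add_le_add (hd j) ?_)
    rw [abs_mul, abs_of_pos hlam]
    exact mul_le_of_le_one_right hlam.le (hsign1 _)
  have hu4 : ‖u‖ ≤ 4 * L * lam := by
    have h1 := hbound u
    rw [hu] at h1
    have h2 := mul_le_mul_of_nonneg_left (hq.trans (by linarith : d + lam ≤ 2 * lam))
      (by positivity : 0 ≤ 2 * L)
    linarith
  let v : ι → ℝ := fun j => if h : j ∈ S then u ⟨j, h⟩ else 0
  have hvS : ∀ j : {j // j ∈ S}, v j = u j := fun j => by simp [v]
  have hvSc : ∀ j ∉ S, v j = 0 := fun j hj => by simp [v, hj]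
  have hAv : ∀ i, (A *ᵥ v) i = ∑ j : {j // j ∈ S}, A i j * u j := fun i => by
    rw [mulVec, dotProduct, sum_eq_sum_subtype_of_support hvSc]
    simp only [hvS]
  have herr : ∀ j ∈ S, |v j| ≤ 4 * L * lam := fun j hj => by
    rw [hvS ⟨j, hj⟩]
    exact (norm_le_pi_norm u ⟨j, hj⟩).trans hu4
  have hsgn : ∀ j, SignType.sign ((b₀ + v) j) = SignType.sign (b₀ j) := by
    intro j
    by_cases hj : j ∈ S
    · refine sign_eq_of_abs_sub_lt ?_
      rw [Pi.add_apply, add_sub_cancel_left]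
      exact (herr j hj).trans_lt (hmin j hj)
    · rw [Pi.add_apply, hvSc j hj, add_zero]
  have hgrad : ∀ j, (A *ᵥ (b₀ + v)) j - r j = (A *ᵥ v) j - (r j - (A *ᵥ b₀) j) := fun j => by
    rw [mulVec_add, Pi.add_apply]; ring
  have hsol := isSolution_and_unique_of_strict_dual_feasible hA (r := r) hlam.le (b := b₀ + v)
    (S := S) (fun j hj => by
      have h1 : (K *ᵥ u) ⟨j, hj⟩ = q ⟨j, hj⟩ := by rw [hu]
      have h2 : (K *ᵥ u) ⟨j, hj⟩ = (A *ᵥ v) j := (hAv j).symm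
      rw [hgrad, hsgn, ← h2, h1]
      simp only [q]; ring)
    (fun j hj => by rw [Pi.add_apply, hb₀ j hj, hvSc j hj, add_zero])
    (fun j hj => by
      rw [hgrad, hAv]
      have h1 : ∑ i : {i // i ∈ S}, A j i * u i
          = (N₀ *ᵥ u) ⟨j, hj⟩ + ∑ i : {i // i ∈ S}, (A j i - A₀ j i) * u i := by
        simp only [hN₀, mulVec, dotProduct, submatrix_apply, ← Finset.sum_add_distrib]
        exact Finset.sum_congr rfl fun i _ => by ring
      have h2 : |(N₀ *ᵥ u) ⟨j, hj⟩| ≤ d + lam + e * ‖u‖ - γ * lam := by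
        have h3 : N₀ *ᵥ u = (N₀ * K₀⁻¹) *ᵥ (K₀ *ᵥ u) := by
          rw [mulVec_mulVec, Matrix.mul_assoc, nonsing_inv_mul _ hdet, Matrix.mul_one]
        have h4 : ‖N₀ *ᵥ u‖ ≤ (1 - γ) * ‖K₀ *ᵥ u‖ := by
          rw [h3]
          exact (norm_mulVec_le_linftyNorm _ _).trans
            (mul_le_mul_of_nonneg_right hirr (norm_nonneg _))
        have h5 : ‖K₀ *ᵥ u‖ ≤ d + lam + e * ‖u‖ := (hK₀v u).trans (by rw [hu]; linarith)
        have h6 : |(N₀ *ᵥ u) ⟨j, hj⟩| ≤ ‖N₀ *ᵥ u‖ := norm_le_pi_norm (N₀ *ᵥ u) ⟨j, hj⟩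
        have h7 := mul_le_mul_of_nonneg_left h5 (sub_nonneg.2 hγ)
        have h8 : 0 ≤ γ * lam := by
          have : 0 ≤ e * L * lam := by positivity
          linarith
        have h9 : 0 ≤ γ := nonneg_of_mul_nonneg_left h8 hlam
        have h10 : 0 ≤ γ * (d + e * ‖u‖) := by positivity
        linarith
      have h3 := hpert j u
      have h4 := hd j
      have h5 := mul_le_mul_of_nonneg_left hu4 he0
      rw [h1]
      calc |(N₀ *ᵥ u) ⟨j, hj⟩ + ∑ i : {i // i ∈ S}, (A j i - A₀ j i) * u i
              - (r j - (A *ᵥ b₀) j)|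
          ≤ |(N₀ *ᵥ u) ⟨j, hj⟩| + |∑ i : {i // i ∈ S}, (A j i - A₀ j i) * u i|
              + |r j - (A *ᵥ b₀) j| := (abs_sub _ _).trans (by gcongr; exact abs_add_le _ _)
        _ < lam := by linarith)
    (fun x hx hAx => by
      have h0 : K *ᵥ (fun j : {j // j ∈ S} => x j) = 0 := by
        funext i
        rw [Pi.zero_apply, ← hAx i i.2, mulVec, dotProduct, mulVec, dotProduct,
          sum_eq_sum_subtype_of_support hx]
        rfl
      have h1 := hbound fun j => x j
      rw [h0, norm_zero, mul_zero] at h1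
      have h2 := norm_le_zero_iff.1 h1
      funext j
      by_cases hj : j ∈ S
      · exact congrFun h2 ⟨j, hj⟩
      · exact hx j hj)
  exact ⟨b₀ + v, hsol.1, hsol.2, hsgn, fun j hj => by
    rw [Pi.add_apply, add_sub_cancel_left]; exact herr j hj⟩

end PrimalDual

end CoCoLasso

/-! ### The event on which the surrogates are accurate -/

namespace CoCoLasso

namespace Regression

variable {n p : ℕ} {Ω : Type*} (M : Regression n p Ω)

lemma mem_S {j : Fin p} : j ∈ M.S ↔ M.βstar j ≠ 0 := by simp [S]

lemma posSemidef_Sigma : M.Sigma.PosSemidef := by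
  have h := posSemidef_conjTranspose_mul_self M.X
  rw [conjTranspose_eq_transpose_of_trivial] at h
  exact h.smul (by positivity)

lemma rho_apply (ω : Ω) (j : Fin p) :
    M.rho ω j = (M.Sigma *ᵥ M.βstar) j + ((1 / (n : ℝ)) • (M.Xᵀ *ᵥ M.w ω)) j := by
  rw [rho, y, Sigma, mulVec_add, smul_add, Pi.add_apply, mulVec_mulVec, smul_mulVec]

lemma betaMin_le {j : Fin p} (hj : j ∈ M.S) : M.betaMin ≤ |M.βstar j| :=
  ciInf_le (f := fun j : {j // j ∈ M.S} => |M.βstar j|) (Set.finite_range _).bddBelow ⟨j, hj⟩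

lemma betaMin_nonneg : 0 ≤ M.betaMin :=
  Real.iInf_nonneg fun _ => abs_nonneg _

lemma betaMin_le_norm (h : M.S.Nonempty) :
    M.betaMin ≤ ‖fun j : {j // j ∈ M.S} => M.βstar j‖ := by
  obtain ⟨j, hj⟩ := h
  exact (M.betaMin_le hj).trans
    (norm_le_pi_norm (fun j : {j // j ∈ M.S} => M.βstar j) ⟨j, hj⟩)

lemma four_mul_linftyNorm_le_kappa : 4 * linftyNorm M.SigmaSS⁻¹ ≤ M.kappa :=
  le_add_of_nonneg_right (by positivity)

/-- The event that the surrogate of `Σ` is within `ε` of `Σ`, and that the surrogate of `ρ` and the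
projected noise `X'w / n` are within `t` of `ρ` and `0`, in every entry. -/
def goodEvent (ε t : ℝ) : Set Ω :=
  {ω | (∀ i j, |M.SigmaHat ω i j - M.Sigma i j| < ε) ∧
    (∀ j, |M.rhoTilde ω j - M.rho ω j| < t) ∧
    ∀ j, |((1 / (n : ℝ)) • (M.Xᵀ *ᵥ M.w ω)) j| < t}

lemma measureReal_compl_goodEvent_le [MeasurableSpace Ω] {μ : Measure Ω} [IsProbabilityMeasure μ]
    {σ C c ζ ε₀ : ℝ} (hM : M.Standing μ σ) (hclose : M.Close μ C c ζ ε₀) (hn : 0 < n)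
    {ε t : ℝ} (hε : 0 < ε) (hε' : ε ≤ ε₀) (ht : 0 < t) (ht' : t ≤ ε₀) :
    μ.real (M.goodEvent ε t)ᶜ ≤ p * (p * (C * Real.exp (-(c * n * ε ^ 2 / ζ))))
      + p * (C * Real.exp (-(c * n * t ^ 2 / ((M.s : ℝ) ^ 2 * ζ))))
      + p * (2 * Real.exp (-(n * t ^ 2 / (32 * σ ^ 2)))) := by
  let E₁ : Fin p → Fin p → Set Ω := fun i j => {ω | ε ≤ |M.SigmaHat ω i j - M.Sigma i j|}
  let E₂ : Fin p → Set Ω := fun j => {ω | t ≤ |M.rhoTilde ω j - M.rho ω j|}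
  let E₃ : Fin p → Set Ω := fun j => {ω | t ≤ |((1 / (n : ℝ)) • (M.Xᵀ *ᵥ M.w ω)) j|}
  have hsub : (M.goodEvent ε t)ᶜ ⊆ ((⋃ i, ⋃ j, E₁ i j) ∪ ⋃ j, E₂ j) ∪ ⋃ j, E₃ j := by
    intro ω hω
    by_contra hcon
    simp only [Set.mem_union, Set.mem_iUnion, not_or, not_exists] at hcon
    exact hω ⟨fun i j => not_le.1 (hcon.1.1 i j), fun j => not_le.1 (hcon.1.2 j),
      fun j => not_le.1 (hcon.2 j)⟩
  have hunion : ∀ (F : Fin p → Set Ω) (x : ℝ), (∀ j, μ.real (F j) ≤ x) →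
      μ.real (⋃ j, F j) ≤ p * x := fun F x hF =>
    (measureReal_iUnion_fintype_le F).trans ((Finset.sum_le_sum fun j _ => hF j).trans (by simp))
  refine (measureReal_mono hsub).trans ((measureReal_union_le _ _).trans (add_le_add
    ((measureReal_union_le _ _).trans (add_le_add ?_ ?_)) ?_))
  · exact hunion _ _ fun i => hunion _ _ fun j => (hclose ε hε hε').1 i j
  · exact hunion _ _ fun j => (hclose t ht ht').2 j
  · exact hunion _ _ fun j => hM.measureReal_abs_noise_ge_le hn j ht.le

/-- On the good event with radii proportional to the tuning parameter, the lasso criterion built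
from the projected surrogate has a unique minimizer, with the right signs and the claimed error. -/
lemma exists_unique_solution_of_mem_goodEvent (hS : M.S.Nonempty) {γ γ₀ K B δ lam : ℝ}
    (hlam : 0 < lam) (hδ : 0 < δ) (hδ₁ : δ * (2 + B) ≤ 1) (hδ₂ : δ * (2 + B) ≤ γ₀ / 4)
    (hγ : γ₀ ≤ γ) (hirr : linftyNorm (M.SigmaScS * M.SigmaSS⁻¹) = 1 - γ) (hCmin : 0 < M.Cmin)
    (hκ : M.kappa ≤ K) (hβ : ‖fun j : {j // j ∈ M.S} => M.βstar j‖ ≤ B)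
    (h₁ : K * (δ * lam) ≤ 2) (h₂ : 8 * (K * (δ * lam)) ≤ γ₀)
    (hmin : K * lam < M.betaMin) {ω : Ω}
    (hω : ω ∈ M.goodEvent (δ * lam / (2 * M.s)) (δ * lam)) {A : Matrix (Fin p) (Fin p) ℝ}
    (hA : IsNearestPSD (M.SigmaHat ω) A) :
    ∃ b, IsSolution A (M.rhoTilde ω) lam b ∧
      (∀ b', IsSolution A (M.rhoTilde ω) lam b' → b' = b) ∧
      (∀ j, SignType.sign (b j) = SignType.sign (M.βstar j)) ∧
      ‖fun j : {j // j ∈ M.S} => b j - M.βstar j‖ ≤ M.kappa * lam := by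
  obtain ⟨hSig, hρ, hw⟩ := hω
  have hs : (0 : ℝ) < M.s := by exact_mod_cast Finset.card_pos.2 hS
  have hB : 0 ≤ B := (norm_nonneg _).trans hβ
  have hsupp : ∀ j ∉ M.S, M.βstar j = 0 := fun j hj => by
    by_contra h
    exact hj (M.mem_S.2 h)
  have hη : ∀ i j, |A i j - M.Sigma i j| ≤ 2 * (δ * lam / (2 * M.s)) :=
    hA.abs_apply_sub_le M.posSemidef_Sigma (by positivity) fun i j => (hSig i j).le
  have hsη : (M.S.card : ℝ) * (2 * (δ * lam / (2 * M.s))) = δ * lam := by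
    change (M.s : ℝ) * _ = _
    field_simp
  set L := linftyNorm M.SigmaSS⁻¹
  have hL0 : 0 ≤ L := linftyNorm_nonneg _
  have hLκ : 4 * L ≤ M.kappa := M.four_mul_linftyNorm_le_kappa
  have hδlam : 0 < δ * lam := mul_pos hδ hlam
  have hLδ : 4 * L * (δ * lam) ≤ K * (δ * lam) :=
    mul_le_mul_of_nonneg_right (hLκ.trans hκ) hδlam.le
  -- the effective noise collects the errors of the two surrogates and the projected noise
  have hd : ∀ j, |M.rhoTilde ω j - (A *ᵥ M.βstar) j| ≤ δ * (2 + B) * lam := by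
    intro j
    have h1 : (A *ᵥ M.βstar) j - (M.Sigma *ᵥ M.βstar) j
        = ∑ i : {i // i ∈ M.S}, (A j i - M.Sigma j i) * M.βstar i := by
      rw [← sum_eq_sum_subtype_of_support hsupp fun i => A j i - M.Sigma j i]
      simp only [mulVec, dotProduct, ← Finset.sum_sub_distrib, sub_mul]
    have h2 : |(A *ᵥ M.βstar) j - (M.Sigma *ᵥ M.βstar) j| ≤ δ * lam * B := by
      rw [h1]
      refine (abs_sum_mul_le (hη j) fun i : {i // i ∈ M.S} => M.βstar i).trans ?_
      rw [hsη]
      exact mul_le_mul_of_nonneg_left hβ hδlam.le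
    have h3 := hρ j
    have h4 := hw j
    rw [M.rho_apply] at h3
    rw [abs_lt] at h3 h4
    rw [abs_le] at h2 ⊢
    constructor <;> linarith
  obtain ⟨b, hb, hb', hsgn, herr⟩ := exists_unique_solution_near hA.1 (A₀ := M.Sigma)
    (r := M.rhoTilde ω) (b₀ := M.βstar) (S := M.S) (L := L) (γ := γ) (e := δ * lam)
    (d := δ * (2 + B) * lam) hlam
    (by linarith [linftyNorm_nonneg (M.SigmaScS * M.SigmaSS⁻¹)]) hsupp
    (isUnit_of_minEigenvalue_pos hCmin) rfl hirr.le hη hsη.le hδlam.le hd (by linarith)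
    (by positivity) (mul_le_of_le_one_left hlam.le hδ₁)
    (by
      have h3 := mul_le_mul_of_nonneg_right hδ₂ hlam.le
      have h4 := mul_le_mul_of_nonneg_right hγ hlam.le
      have h5 := mul_le_mul_of_nonneg_right (hLδ.trans (by linarith : _ ≤ γ₀ / 8)) hlam.le
      have h6 : 0 < γ₀ * lam := by
        have : 0 < δ * (2 + B) := by positivity
        exact mul_pos (by linarith) hlam
      linarith)
    (fun j hj => (mul_le_mul_of_nonneg_right (hLκ.trans hκ) hlam.le).trans_lt
      (hmin.trans_le (M.betaMin_le hj)))
  refine ⟨b, hb, hb', hsgn, (pi_norm_le_iff_of_nonneg ?_).2 fun j => ?_⟩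
  · exact mul_nonneg (by linarith) hlam.le
  · exact (herr j j.2).trans (mul_le_mul_of_nonneg_right hLκ hlam.le)

end Regression

lemma ProbTendstoOne.mono {Ω : ℕ → Type*} [∀ k, MeasurableSpace (Ω k)] {μ : ∀ k, Measure (Ω k)}
    {A B : ∀ k, Set (Ω k)} (hA : ProbTendstoOne μ A) (h : ∀ᶠ k in atTop, A k ⊆ B k) :
    ProbTendstoOne μ B :=
  tendsto_of_tendsto_of_tendsto_of_le_of_le' tendsto_const_nhds hA
    (Eventually.of_forall fun _ => zero_le)
    (h.mono fun _ hk => measure_mono (Set.compl_subset_compl.2 hk))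

/-- If the tuning parameter dominates `s (ζ log p / n)^{1/2}`, the exponents in the tail bounds at
radii proportional to it exceed any multiple of `log p`; the union bound then costs nothing. -/
lemma probTendstoOne_goodEvent {Ω : ℕ → Type*} [∀ k, MeasurableSpace (Ω k)]
    (μ : ∀ k, Measure (Ω k)) [∀ k, IsProbabilityMeasure (μ k)]
    (n p : ℕ → ℕ) (hn : Tendsto n atTop atTop) (hp : Tendsto p atTop atTop)
    (M : ∀ k, Regression (n k) (p k) (Ω k)) (σ : ℕ → ℝ) (hM : ∀ k, (M k).Standing (μ k) (σ k))
    (C c : ℝ) (hC : 0 < C) (hc : 0 < c) (ζ ε₀ : ℕ → ℝ) (hζ : ∀ k, 0 < ζ k)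
    (hclose : ∀ k, (M k).Close (μ k) C c (ζ k) (ε₀ k))
    (hσζ : (fun k => σ k ^ 2) =O[atTop] ζ)
    (lam : ℕ → ℝ) (hlam : ∀ k, 0 < lam k) (hlam_le : ∀ᶠ k in atTop, lam k ≤ ε₀ k)
    (hlam_lower : (fun k => ((M k).s : ℝ) * Real.sqrt (ζ k * Real.log (p k) / n k))
      =o[atTop] lam) {δ : ℝ} (hδ : 0 < δ) (hδ1 : δ ≤ 1) :
    ProbTendstoOne μ fun k => (M k).goodEvent (δ * lam k / (2 * (M k).s)) (δ * lam k) := by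
  obtain ⟨a₀, ha₀, hσ⟩ := hσζ.exists_pos
  rw [isBigOWith_iff] at hσ
  set a : ℝ := min (c * δ ^ 2 / 4) (δ ^ 2 / (32 * a₀))
  have ha0 : 0 < a := lt_min (by positivity) (by positivity)
  have hlow := hlam_lower.def (Real.sqrt_pos.2 (by positivity : 0 < a / 3))
  have hbound : ∀ᶠ k in atTop,
      μ k ((M k).goodEvent (δ * lam k / (2 * (M k).s)) (δ * lam k))ᶜ
        ≤ ENNReal.ofReal ((2 * C + 2) / p k) := by
    filter_upwards [hσ, hlow, hlam_le, hn.eventually_ge_atTop 1, hp.eventually_ge_atTop 1]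
      with k hσk hlk hle hnk hpk
    have hnp : (0 : ℝ) < n k := by exact_mod_cast hnk
    have hpp : (1 : ℝ) ≤ p k := by exact_mod_cast hpk
    have hs1 : (1 : ℝ) ≤ (M k).s := by
      exact_mod_cast Finset.card_pos.2 (hM k).support_nonempty
    have hs0 : (0 : ℝ) < (M k).s := by linarith
    have hζk := hζ k
    have hlamk := hlam k
    have hσpos := (hM k).sigma_pos
    have hlog : 0 ≤ Real.log (p k) := Real.log_nonneg hpp
    rw [Real.norm_of_nonneg (by positivity), Real.norm_of_nonneg hζk.le] at hσk
    rw [Real.norm_of_nonneg (by positivity), Real.norm_of_nonneg hlamk.le] at hlk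
    set s : ℝ := ((M k).s : ℝ)
    set Q : ℝ := n k * lam k ^ 2 / (s ^ 2 * ζ k) with hQ
    have hQ0 : 0 ≤ Q := by positivity
    have hQlog : 3 * Real.log (p k) ≤ a * Q := by
      have h1 := pow_le_pow_left₀ (by positivity) hlk 2
      rw [mul_pow, mul_pow, Real.sq_sqrt (by positivity), Real.sq_sqrt (by positivity)] at h1
      have h2 : s ^ 2 * (ζ k * Real.log (p k) / n k)
          = Real.log (p k) * (s ^ 2 * ζ k / n k) := by ring
      have h3 : a / 3 * lam k ^ 2 = a / 3 * Q * (s ^ 2 * ζ k / n k) := by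
        rw [hQ]; field_simp
      rw [h2, h3] at h1
      have h4 := le_of_mul_le_mul_right h1 (by positivity)
      linarith
    -- `p⁻³` absorbs the `p²` entries of the matrix and leaves a factor `1 / p`
    have hexp : ∀ x : ℝ, a * Q ≤ x → Real.exp (-x) ≤ 1 / (p k : ℝ) ^ 3 := by
      intro x hx
      calc Real.exp (-x) ≤ Real.exp (-(3 * Real.log (p k))) :=
            Real.exp_le_exp.2 (by linarith)
        _ = 1 / (p k : ℝ) ^ 3 := by
            rw [Real.exp_neg, mul_comm, Real.exp_mul, Real.exp_log (by linarith), one_div]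
            norm_cast
    have he₁ : a * Q ≤ c * n k * (δ * lam k / (2 * s)) ^ 2 / ζ k := by
      calc a * Q ≤ c * δ ^ 2 / 4 * Q := mul_le_mul_of_nonneg_right (min_le_left _ _) hQ0
        _ = _ := by rw [hQ]; field_simp; norm_num
    have he₂ : a * Q ≤ c * n k * (δ * lam k) ^ 2 / (s ^ 2 * ζ k) := by
      calc a * Q ≤ c * δ ^ 2 / 4 * Q := mul_le_mul_of_nonneg_right (min_le_left _ _) hQ0
        _ ≤ c * δ ^ 2 * Q := by
            have : 0 ≤ c * δ ^ 2 * Q := by positivity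
            linarith
        _ = _ := by rw [hQ]; field_simp
    have he₃ : a * Q ≤ n k * (δ * lam k) ^ 2 / (32 * σ k ^ 2) := by
      calc a * Q ≤ δ ^ 2 / (32 * a₀) * Q := mul_le_mul_of_nonneg_right (min_le_right _ _) hQ0
        _ = n k * (δ * lam k) ^ 2 / (32 * (a₀ * ζ k) * s ^ 2) := by rw [hQ]; field_simp
        _ ≤ n k * (δ * lam k) ^ 2 / (32 * σ k ^ 2) := by
            refine div_le_div_of_nonneg_left (by positivity) (by positivity) ?_
            have h1 : 1 ≤ s ^ 2 := one_le_pow₀ hs1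
            calc 32 * σ k ^ 2 ≤ 32 * (a₀ * ζ k) := by linarith
              _ ≤ 32 * (a₀ * ζ k) * s ^ 2 := le_mul_of_one_le_right (by positivity) h1
    have ht : δ * lam k ≤ ε₀ k := (mul_le_of_le_one_left hlamk.le hδ1).trans hle
    have hε : δ * lam k / (2 * s) ≤ ε₀ k :=
      (div_le_self (by positivity) (by linarith)).trans ht
    have hmain := (M k).measureReal_compl_goodEvent_le (hM k) (hclose k) hnk
      (ε := δ * lam k / (2 * s)) (t := δ * lam k) (by positivity) hε (by positivity) ht
    rw [← ofReal_measureReal (measure_ne_top _ _)]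
    refine ENNReal.ofReal_le_ofReal (hmain.trans ?_)
    set P : ℝ := (p k : ℝ)
    calc _ ≤ P * (P * (C * (1 / P ^ 3))) + P * (C * (1 / P ^ 3)) + P * (2 * (1 / P ^ 3)) := by
          gcongr
          · exact hexp _ he₁
          · exact hexp _ he₂
          · exact hexp _ he₃
      _ = C / P + (C + 2) / P * (1 / P) := by field_simp; ring
      _ ≤ C / P + (C + 2) / P * 1 := by
          gcongr
          exact (div_le_one (by linarith)).2 hpp
      _ = (2 * C + 2) / P := by ring
  refine tendsto_of_tendsto_of_tendsto_of_le_of_le' tendsto_const_nhds ?_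
    (Eventually.of_forall fun _ => zero_le) hbound
  have h1 : Tendsto (fun k => (2 * C + 2) / (p k : ℝ)) atTop (𝓝 0) :=
    tendsto_const_nhds.div_atTop (tendsto_natCast_atTop_atTop.comp hp)
  simpa using ENNReal.tendsto_ofReal h1

end CoCoLasso

/-! ### Sign consistency -/

theorem corollary1
    -- a sequence of problems, indexed by `k`, with `n, p → ∞`
    {Ω : ℕ → Type*} [∀ k, MeasurableSpace (Ω k)] (μ : ∀ k, Measure (Ω k))
    [∀ k, IsProbabilityMeasure (μ k)]
    (n p : ℕ → ℕ) (hn : Tendsto n atTop atTop) (hp : Tendsto p atTop atTop)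
    (M : ∀ k, CoCoLasso.Regression (n k) (p k) (Ω k))
    (σ : ℕ → ℝ) (hM : ∀ k, (M k).Standing (μ k) (σ k))
    -- closeness condition, with universal constants `C`, `c`; `ζ` dominates the noise level
    (C c : ℝ) (hC : 0 < C) (hc : 0 < c)
    (ζ ε₀ : ℕ → ℝ) (hζ : ∀ k, 0 < ζ k) (hε₀ : ∀ k, 0 < ε₀ k)
    (hclose : ∀ k, (M k).Close (μ k) C c (ζ k) (ε₀ k))
    (hσζ : (fun k => σ k ^ 2) =O[atTop] ζ)
    -- irrepresentable and minimum eigenvalue conditions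
    (γ : ℕ → ℝ) (γ₀ : ℝ) (hγ₀ : 0 < γ₀) (hγ : ∀ k, γ₀ ≤ γ k)
    (hirr : ∀ k, CoCoLasso.linftyNorm ((M k).SigmaScS * (M k).SigmaSS⁻¹) = 1 - γ k)
    (hCmin : ∀ k, 0 < (M k).Cmin)
    -- `κ = O(1)` and `‖β*_S‖_∞ = O(1)`
    (hκ : (fun k => (M k).kappa) =O[atTop] fun _ => (1 : ℝ))
    (hβ : (fun k => ‖fun j : {j // j ∈ (M k).S} => (M k).βstar j‖) =O[atTop] fun _ => (1 : ℝ))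
    -- scaling
    (hscale : Tendsto (fun k => ((M k).s : ℝ) ^ 2 * Real.log (p k) / n k) atTop (𝓝 0))
    (hβmin : (fun k => ((M k).s : ℝ) * Real.sqrt (ζ k * Real.log (p k) / n k))
      =o[atTop] fun k => (M k).betaMin)
    -- tuning parameter
    (lam : ℕ → ℝ) (hlam : ∀ k, 0 < lam k)
    (hlam_le : ∀ᶠ k in atTop, lam k ≤ min (ε₀ k) (4 * ε₀ k / γ k))
    (hlam_upper : lam =o[atTop] fun k => (M k).betaMin)
    (hlam_lower : (fun k => ((M k).s : ℝ) * Real.sqrt (ζ k * Real.log (p k) / n k))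
      =o[atTop] lam)
    -- the projected surrogate and the CoCoLasso estimate (a minimizer whenever there is one)
    (SigmaTilde : ∀ k, Ω k → Matrix (Fin (p k)) (Fin (p k)) ℝ)
    (hSigmaTilde : ∀ k ω, CoCoLasso.IsNearestPSD ((M k).SigmaHat ω) (SigmaTilde k ω))
    (βhat : ∀ k, Ω k → Fin (p k) → ℝ)
    (hβhat : ∀ k ω,
      (∃ b, CoCoLasso.IsSolution (SigmaTilde k ω) ((M k).rhoTilde ω) (lam k) b) →
        CoCoLasso.IsSolution (SigmaTilde k ω) ((M k).rhoTilde ω) (lam k) (βhat k ω)) :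
    -- the estimate is well defined, sign-consistent, and satisfies the `ℓ_∞` error bound
    CoCoLasso.ProbTendstoOne μ (fun k => {ω |
      ∃! b, CoCoLasso.IsSolution (SigmaTilde k ω) ((M k).rhoTilde ω) (lam k) b}) ∧
    CoCoLasso.ProbTendstoOne μ (fun k => {ω |
      ∀ j, SignType.sign (βhat k ω j) = SignType.sign ((M k).βstar j)}) ∧
    CoCoLasso.ProbTendstoOne μ (fun k => {ω |
      ‖fun j : {j // j ∈ (M k).S} => βhat k ω j - (M k).βstar j‖ ≤ (M k).kappa * lam k}) := by
  obtain ⟨K, hK, hκK⟩ := hκ.exists_pos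
  obtain ⟨B, hB, hβB⟩ := hβ.exists_pos
  rw [isBigOWith_iff] at hκK hβB
  -- `δ` is the ratio of the entrywise accuracy of the surrogates to the tuning parameter
  obtain ⟨δ, hδ, hδ1, hδ₁, hδ₂⟩ : ∃ δ : ℝ, 0 < δ ∧ δ ≤ 1 ∧ δ * (2 + B) ≤ 1 ∧
      δ * (2 + B) ≤ γ₀ / 4 := by
    have h2 : 0 < 2 + B := by linarith
    refine ⟨min 1 (γ₀ / 4) / (2 + B), by positivity, ?_, ?_, ?_⟩
    · exact (div_le_one h2).2 ((min_le_left _ _).trans (by linarith))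
    · rw [div_mul_cancel₀ _ h2.ne']; exact min_le_left _ _
    · rw [div_mul_cancel₀ _ h2.ne']; exact min_le_right _ _
  have hgood := CoCoLasso.probTendstoOne_goodEvent μ n p hn hp M σ hM C c hC hc ζ ε₀ hζ hclose
    hσζ lam hlam (hlam_le.mono fun k hk => hk.trans (min_le_left _ _)) hlam_lower hδ hδ1
  -- `λ → 0`, since `λ ≪ |β*_min| ≤ ‖β*_S‖_∞ = O(1)`
  have hlam0 : Tendsto lam atTop (𝓝 0) := by
    refine (isLittleO_one_iff ℝ).1 (hlam_upper.trans_isBigO (IsBigO.trans ?_ hβ))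
    refine IsBigO.of_bound 1 (Eventually.of_forall fun k => ?_)
    rw [one_mul, Real.norm_of_nonneg (M k).betaMin_nonneg, norm_norm]
    exact (M k).betaMin_le_norm (hM k).support_nonempty
  have hsmall : Tendsto (fun k => K * (δ * lam k)) atTop (𝓝 0) := by
    simpa using (hlam0.const_mul δ).const_mul K
  have hkey : ∀ᶠ k in atTop, ∀ ω ∈ (M k).goodEvent (δ * lam k / (2 * (M k).s)) (δ * lam k),
      ∃ b, CoCoLasso.IsSolution (SigmaTilde k ω) ((M k).rhoTilde ω) (lam k) b ∧
        (∀ b', CoCoLasso.IsSolution (SigmaTilde k ω) ((M k).rhoTilde ω) (lam k) b' → b' = b) ∧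
        (∀ j, SignType.sign (b j) = SignType.sign ((M k).βstar j)) ∧
        ‖fun j : {j // j ∈ (M k).S} => b j - (M k).βstar j‖ ≤ (M k).kappa * lam k := by
    filter_upwards [hκK, hβB, hlam_upper.def (by positivity : 0 < 1 / (2 * K)),
      hsmall.eventually_le_const (by norm_num : (0 : ℝ) < 2),
      hsmall.eventually_le_const (by positivity : 0 < γ₀ / 8)] with k h1 h2 h3 h4 h5 ω hω
    rw [norm_one, mul_one] at h1 h2
    rw [norm_norm] at h2
    rw [Real.norm_of_nonneg (hlam k).le, Real.norm_of_nonneg (M k).betaMin_nonneg,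
      one_div_mul_eq_div, le_div_iff₀ (by positivity)] at h3
    have h6 := mul_pos hK (hlam k)
    exact (M k).exists_unique_solution_of_mem_goodEvent (hM k).support_nonempty (hlam k) hδ hδ₁
      hδ₂ (hγ k) (hirr k) (hCmin k) ((le_abs_self _).trans h1) h2 h4 (by linarith) (by linarith)
      hω (hSigmaTilde k ω)
  refine ⟨hgood.mono ?_, hgood.mono ?_, hgood.mono ?_⟩
  · filter_upwards [hkey] with k hk ω hω
    obtain ⟨b, hb, hb', -⟩ := hk ω hω
    exact ⟨b, hb, hb'⟩
  · filter_upwards [hkey] with k hk ω hω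
    obtain ⟨b, hb, hb', hsgn, -⟩ := hk ω hω
    rw [← hb' _ (hβhat k ω ⟨b, hb⟩)] at hsgn
    exact hsgn
  · filter_upwards [hkey] with k hk ω hω
    obtain ⟨b, hb, hb', -, herr⟩ := hk ω hω
    rw [← hb' _ (hβhat k ω ⟨b, hb⟩)] at herr
    exact herr
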